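/- Let $n\ge 2$, let $C\in\mathbb{R}^{n\times n}$ be row-stochastic (nonnegative entries, row sums $1$) with zero diagonal, and let $\theta\in[0,1)^n$ with $\theta_j>0$ for at least one $j$. Put $\Theta=\operatorname{diag}(\theta)$, $\Delta_n=\{x\in\mathbb{R}^n : x\ge 0,\ \sum_i x_i=1\}$, $\operatorname{int}\Delta_n=\{x\in\mathbb{R}^n : x_i>0 \text{ for all } i,\ \sum_i x_i=1\}$, and let $\Gamma_n$ be the set of row-stochastic $n\times n$ matrices. For $x\in\mathbb{R}^n$ let $W(x)=\operatorname{diag}(x)+(I_n-\operatorname{diag}(x))C$. Consider the issue-sequence model $x(s+1)=F(x(s))$ on $\Delta_n$, with $$F(x)=(I_n-\Theta)(I_n-W(x)^{T}\Theta)^{-1}\frac{\mathbf{1}_n}{n},$$ and the single-issue model $(V(k+1),x(k+1))=G(V(k),x(k))$ on $\Gamma_n\times\Delta_n$, with $$G(V,x)=\Bigl(G_V(V,x),\ G_V(V,x)^{T}\frac{\mathbf{1}_n}{n}\Bigr),\qquad G_V(V,x)=\Theta W(x)V+I_n-\Theta .$$ An equilibrium of the first model is $x^*\in\Delta_n$ with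 $F(x^*)=x^*$. An equilibrium of the second is $(V^*,x^*)\in\Gamma_n\times\Delta_n$ with $G(V^*,x^*)=(V^*,x^*)$. In both cases $x^*$ is called an equilibrium social power. Call $i$ fully stubborn if $\theta_i=0$ and partially stubborn if $\theta_i>0$. Let $\theta_{\mathrm{ave}}=\frac1n\sum_i\theta_i$, $\theta_{\max}=\max_i\theta_i$, $\theta_{\min}=\min_i\theta_i$ and $\zeta=n\theta_{\mathrm{ave}}-\theta_{\min}$. Both models are well defined: for every $x\in\Delta_n$ the matrix $I_n-W(x)^{T}\Theta$ is invertible, $F$ maps $\Delta_n$ into itself, and $G$ maps $\Gamma_n\times\Delta_n$ into itself. Moreover: 1. There is at least one $x^*$ that is an equilibrium social power of both models. Every equilibrium social power $x^*$ of either model satisfies: (a) $x^*\in\operatorname{int}\Delta_n$; (b) for every fully stubborn $i$: $x_i^*\ge 1/n$, with equality if and only if $C_{ji}=0$ for all partially stubborn $j$; (c) for every partially stubborn $i$: $x_i^*>(1-\theta_i)/n$, and $x_i^*<1/n$ if $C_{ji}=0$ for all partially stubborn $j$; (d) $\max_i x_i^*<1/n+\theta_{\mathrm{ave}}$. 2.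 If $\theta_{\max}<\dfrac{n}{n+2(1+\zeta)}$, then $F$ is a contraction of $\Delta_n$ in the $1$-norm, that is, there is $\kappa\in[0,1)$ with $\|F(y)-F(z)\|_1\le\kappa\|y-z\|_1$ for all $y,z\in\Delta_n$. In that case the equilibrium social power $x^*$ is unique and is the same for both models. -/

import Mathlib

open scoped Matrix

noncomputable section

/-- The interior of the simplex: `x > 0` componentwise, with components summing to `1`. -/
def simplexInterior (n : ℕ) : Set (Fin n → ℝ) :=
  {x | (∀ i, 0 < x i) ∧ ∑ i, x i = 1}

/-- The constant vector `𝟏ₙ / n`. -/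
def democracy (n : ℕ) : Fin n → ℝ := fun _ => 1 / (n : ℝ)

/-- The influence matrix `W(x) = diag(x) + (I - diag(x)) C`. -/
def influence {n : ℕ} (C : Matrix (Fin n) (Fin n) ℝ) (x : Fin n → ℝ) :
    Matrix (Fin n) (Fin n) ℝ :=
  Matrix.diagonal x + (1 - Matrix.diagonal x) * C

/-- The map `F(x) = (I - Θ) (I - W(x)ᵀ Θ)⁻¹ 𝟏ₙ / n` of the issue-sequence model
`x(s+1) = F(x(s))`, where `Θ = diag(θ)`. -/
def issueMap {n : ℕ} (C : Matrix (Fin n) (Fin n) ℝ) (θ : Fin n → ℝ) (x : Fin n → ℝ) :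
    Fin n → ℝ :=
  ((1 - Matrix.diagonal θ) * (1 - (influence C x)ᵀ * Matrix.diagonal θ)⁻¹) *ᵥ democracy n

/-- The `V`-component `Θ W(x) V + I - Θ` of the map of the single-issue model. -/
def singleIssueV {n : ℕ} (C : Matrix (Fin n) (Fin n) ℝ) (θ : Fin n → ℝ)
    (p : Matrix (Fin n) (Fin n) ℝ × (Fin n → ℝ)) : Matrix (Fin n) (Fin n) ℝ :=
  Matrix.diagonal θ * influence C p.2 * p.1 + 1 - Matrix.diagonal θ

/-- The map `G(V, x) = (G_V(V, x), G_V(V, x)ᵀ 𝟏ₙ / n)` of the single-issue model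
`(V(k+1), x(k+1)) = G(V(k), x(k))`. -/
def singleIssueMap {n : ℕ} (C : Matrix (Fin n) (Fin n) ℝ) (θ : Fin n → ℝ)
    (p : Matrix (Fin n) (Fin n) ℝ × (Fin n → ℝ)) :
    Matrix (Fin n) (Fin n) ℝ × (Fin n → ℝ) :=
  (singleIssueV C θ p, (singleIssueV C θ p)ᵀ *ᵥ democracy n)

/-- `x` is an equilibrium of the issue-sequence model: a fixed point of `F` in the simplex. -/
def IsIssueEquilibrium {n : ℕ} (C : Matrix (Fin n) (Fin n) ℝ) (θ : Fin n → ℝ)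
    (x : Fin n → ℝ) : Prop :=
  x ∈ stdSimplex ℝ (Fin n) ∧ Function.IsFixedPt (issueMap C θ) x

/-- `(V, x)` is an equilibrium of the single-issue model: `V` is row-stochastic, `x` lies in the
simplex, and `(V, x)` is a fixed point of `G`. -/
def IsSingleIssueEquilibrium {n : ℕ} (C : Matrix (Fin n) (Fin n) ℝ) (θ : Fin n → ℝ)
    (V : Matrix (Fin n) (Fin n) ℝ) (x : Fin n → ℝ) : Prop :=
  V ∈ Matrix.rowStochastic ℝ (Fin n) ∧ x ∈ stdSimplex ℝ (Fin n) ∧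
    Function.IsFixedPt (singleIssueMap C θ) (V, x)

/-- The average susceptibility. -/
def thetaAve {n : ℕ} (θ : Fin n → ℝ) : ℝ := (∑ i, θ i) / (n : ℝ)

/-- The largest susceptibility (a maximum, as `Fin n` is finite and, for `n ≥ 2`, nonempty). -/
def thetaMax {n : ℕ} (θ : Fin n → ℝ) : ℝ := ⨆ i, θ i

/-- The smallest susceptibility (a minimum, as `Fin n` is finite and, for `n ≥ 2`, nonempty). -/
def thetaMin {n : ℕ} (θ : Fin n → ℝ) : ℝ := ⨅ i, θ i

/-- `ζ = n θ_ave - θ_min`. -/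
def zeta {n : ℕ} (θ : Fin n → ℝ) : ℝ := (n : ℝ) * thetaAve θ - thetaMin θ

end

/-! For row-stochastic `W` a minimum principle makes `I - ΘW` invertible, and `V = (I - ΘW)⁻¹(I -
Θ)` is again row-stochastic. Since `F(x) = V(x)ᵀ 𝟏/n`, and the `V`-component of a fixed point of `G`
must be `V(x)`, the two models have the same equilibrium social powers.

The properties of an equilibrium come from the linear system behind `F`, whose terms are
nonnegative, and from the bound `V i j ≤ θ i` off the diagonal. For the contraction, `F(x) - F(x') =
V(x)ᵀ r` with `‖r‖₁ ≤ 2B‖x - x'‖₁`, where `B` bounds `θ i * F(x') i / (1 - θ i)`; transposes of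
row-stochastic matrices do not increase the 1-norm.

Existence avoids Brouwer's theorem. With `a_i(x) = θ_i x(1 - x)/(1 - θ_i)` the equilibrium equations
are `x_i + a_i(x_i) = 1/n + ∑ j, C j i * a_j(x_j)`, and summing them forces total power `1`. With
`a_i` frozen outside `[0, 1/2]` it is monotone, and as a function of `u_i = x_i + a_i(x_i)` it is
`θ_i`-Lipschitz, so Banach's theorem in the 1-norm solves the modified system. If no power exceeds
`1/2` this is an equilibrium. Otherwise some `x_c > 1/2`; prescribing `x_c = t` and solving the
rest, the intermediate value theorem gives `t ∈ [1/2, 1]` with total power `1`. Every other power is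
then at most `1/2`, so freezing has no effect on it. -/

/-! ### Minimum principle and invertibility -/

/-- A vector dominating its damped average under a row-stochastic matrix is nonnegative. -/
theorem nonneg_of_damped_average_le {n : ℕ} {W : Matrix (Fin n) (Fin n) ℝ} {θ : Fin n → ℝ}
    (hW : W ∈ Matrix.rowStochastic ℝ (Fin n)) (hθ0 : ∀ i, 0 ≤ θ i) (hθ1 : ∀ i, θ i < 1)
    {v : Fin n → ℝ} (h : ∀ i, θ i * ∑ j, W i j * v j ≤ v i) (i : Fin n) : 0 ≤ v i := by
  have : Nonempty (Fin n) := ⟨i⟩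
  obtain ⟨k, hk⟩ := Finite.exists_min v
  rw [Matrix.mem_rowStochastic_iff_sum] at hW
  -- At a minimizer `k` the average is at least `v k`, so `θ k * v k ≤ v k`, which excludes `v k <
  -- 0` because `θ k < 1`.
  have h1 : v k ≤ ∑ j, W k j * v j := by
    calc v k = ∑ j, W k j * v k := by rw [← Finset.sum_mul, hW.2 k, one_mul]
      _ ≤ _ := Finset.sum_le_sum fun j _ => mul_le_mul_of_nonneg_left (hk j) (hW.1 k j)
  have h2 := (mul_le_mul_of_nonneg_left h1 (hθ0 k)).trans (h k)
  have h3 : 0 ≤ v k := by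
    by_contra! hneg
    nlinarith [hθ1 k]
  exact h3.trans (hk i)

theorem diagonal_mul_mulVec_apply {n : ℕ} (W : Matrix (Fin n) (Fin n) ℝ) (θ v : Fin n → ℝ)
    (i : Fin n) : ((Matrix.diagonal θ * W) *ᵥ v) i = θ i * ∑ j, W i j * v j := by
  rw [← Matrix.mulVec_mulVec, Matrix.mulVec_diagonal]
  rfl

/-- The minimum principle applies to a kernel vector and to its negative, so the kernel is trivial.
-/
theorem isUnit_one_sub_diagonal_mul {n : ℕ} {W : Matrix (Fin n) (Fin n) ℝ} {θ : Fin n → ℝ}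
    (hW : W ∈ Matrix.rowStochastic ℝ (Fin n)) (hθ0 : ∀ i, 0 ≤ θ i) (hθ1 : ∀ i, θ i < 1) :
    IsUnit (1 - Matrix.diagonal θ * W) := by
  rw [← Matrix.mulVec_injective_iff_isUnit]
  have key : ∀ v : Fin n → ℝ, (1 - Matrix.diagonal θ * W) *ᵥ v = 0 → ∀ i, 0 ≤ v i := by
    intro v hv
    refine nonneg_of_damped_average_le hW hθ0 hθ1 fun i => ?_
    have := congrFun hv i
    rw [Matrix.sub_mulVec, Matrix.one_mulVec, Pi.sub_apply, diagonal_mul_mulVec_apply,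
      Pi.zero_apply] at this
    linarith
  intro v w hvw
  have hz : (1 - Matrix.diagonal θ * W) *ᵥ (v - w) = 0 := by
    rw [Matrix.mulVec_sub, sub_eq_zero]; exact hvw
  have hz' : (1 - Matrix.diagonal θ * W) *ᵥ (-(v - w)) = 0 := by
    rw [Matrix.mulVec_neg, hz, neg_zero]
  ext i
  have h1 := key _ hz i
  have h2 := key _ hz' i
  simp only [Pi.neg_apply, Pi.sub_apply] at h1 h2
  linarith

theorem influence_mem_rowStochastic {n : ℕ} {C : Matrix (Fin n) (Fin n) ℝ} {x : Fin n → ℝ}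
    (hC : C ∈ Matrix.rowStochastic ℝ (Fin n)) (hx : x ∈ stdSimplex ℝ (Fin n)) :
    influence C x ∈ Matrix.rowStochastic ℝ (Fin n) := by
  rw [Matrix.mem_rowStochastic_iff_sum] at hC ⊢
  have hx1 : ∀ i, x i ≤ 1 := fun i =>
    hx.2 ▸ Finset.single_le_sum (f := x) (fun j _ => hx.1 j) (Finset.mem_univ i)
  have e : ∀ i j, influence C x i j = (Matrix.diagonal x) i j + (1 - x i) * C i j := by
    intro i j
    simp only [influence, Matrix.sub_mul, Matrix.one_mul, Matrix.add_apply, Matrix.sub_apply,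
      Matrix.diagonal_mul]
    ring
  constructor
  · intro i j
    rw [e]
    refine add_nonneg ?_ (mul_nonneg (by linarith [hx1 i]) (hC.1 i j))
    rw [Matrix.diagonal_apply]
    split_ifs
    exacts [hx.1 i, le_rfl]
  · intro i
    simp only [e, Finset.sum_add_distrib, ← Finset.mul_sum, hC.2, Matrix.diagonal_apply,
      Finset.sum_ite_eq, Finset.mem_univ, if_true]
    ring

/-! ### The limit opinion matrix -/

/-- The limit `(I - Θ W)⁻¹ (I - Θ)` of the opinion process with influence matrix `W`. -/
noncomputable def opinionLimit {n : ℕ} (θ : Fin n → ℝ) (W : Matrix (Fin n) (Fin n) ℝ) :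
    Matrix (Fin n) (Fin n) ℝ :=
  (1 - Matrix.diagonal θ * W)⁻¹ * (1 - Matrix.diagonal θ)

theorem eq_opinionLimit_iff {n : ℕ} {W : Matrix (Fin n) (Fin n) ℝ} {θ : Fin n → ℝ}
    (hW : W ∈ Matrix.rowStochastic ℝ (Fin n)) (hθ0 : ∀ i, 0 ≤ θ i) (hθ1 : ∀ i, θ i < 1)
    (V : Matrix (Fin n) (Fin n) ℝ) :
    V = opinionLimit θ W ↔
      Matrix.diagonal θ * W * V + 1 - Matrix.diagonal θ = V := by
  have hu := (Matrix.isUnit_iff_isUnit_det _).1 (isUnit_one_sub_diagonal_mul hW hθ0 hθ1)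
  have e : Matrix.diagonal θ * W * V + 1 - Matrix.diagonal θ = V ↔
      (1 - Matrix.diagonal θ * W) * V = 1 - Matrix.diagonal θ := by
    rw [Matrix.sub_mul, Matrix.one_mul, sub_eq_sub_iff_add_eq_add, sub_eq_iff_eq_add,
      add_comm _ (1 : Matrix (Fin n) (Fin n) ℝ)]
    exact eq_comm
  rw [e, opinionLimit]
  constructor
  · rintro rfl
    rw [Matrix.mul_nonsing_inv_cancel_left _ _ hu]
  · intro h
    rw [← h, Matrix.nonsing_inv_mul_cancel_left _ _ hu]

theorem opinionLimit_apply {n : ℕ} {W : Matrix (Fin n) (Fin n) ℝ} {θ : Fin n → ℝ}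
    (hW : W ∈ Matrix.rowStochastic ℝ (Fin n)) (hθ0 : ∀ i, 0 ≤ θ i) (hθ1 : ∀ i, θ i < 1)
    (i j : Fin n) :
    opinionLimit θ W i j = θ i * ∑ k, W i k * opinionLimit θ W k j +
      if i = j then 1 - θ i else 0 := by
  have h := (eq_opinionLimit_iff hW hθ0 hθ1 _).1 rfl
  conv_lhs => rw [← h]
  rw [Matrix.mul_assoc, Matrix.sub_apply, Matrix.add_apply, Matrix.diagonal_mul, Matrix.mul_apply,
    Matrix.one_apply, Matrix.diagonal_apply]
  split_ifs <;> ring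

/-- Each column dominates its damped average, hence is nonnegative; the row sums follow from `(I -
ΘW)𝟏 = (I - Θ)𝟏`. -/
theorem opinionLimit_mem_rowStochastic {n : ℕ} {W : Matrix (Fin n) (Fin n) ℝ} {θ : Fin n → ℝ}
    (hW : W ∈ Matrix.rowStochastic ℝ (Fin n)) (hθ0 : ∀ i, 0 ≤ θ i) (hθ1 : ∀ i, θ i < 1) :
    opinionLimit θ W ∈ Matrix.rowStochastic ℝ (Fin n) := by
  have hu := (Matrix.isUnit_iff_isUnit_det _).1 (isUnit_one_sub_diagonal_mul hW hθ0 hθ1)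
  rw [Matrix.mem_rowStochastic]
  constructor
  · intro i j
    refine nonneg_of_damped_average_le hW hθ0 hθ1 (v := fun i => opinionLimit θ W i j)
      (fun i => ?_) i
    rw [opinionLimit_apply hW hθ0 hθ1 i j]
    refine le_add_of_nonneg_right ?_
    split_ifs
    exacts [by linarith [hθ1 i], le_rfl]
  · have h1 : (1 - Matrix.diagonal θ * W) *ᵥ 1 = (1 - Matrix.diagonal θ) *ᵥ (1 : Fin n → ℝ) := by
      rw [Matrix.sub_mulVec, Matrix.sub_mulVec, ← Matrix.mulVec_mulVec,
        (Matrix.mem_rowStochastic.1 hW).2]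
    rw [opinionLimit, ← Matrix.mulVec_mulVec, ← h1, Matrix.mulVec_mulVec,
      Matrix.nonsing_inv_mul _ hu, Matrix.one_mulVec]

theorem transpose_one_sub_diagonal_mul {n : ℕ} (W : Matrix (Fin n) (Fin n) ℝ) (θ : Fin n → ℝ) :
    (1 - Matrix.diagonal θ * W)ᵀ = 1 - Wᵀ * Matrix.diagonal θ := by
  rw [Matrix.transpose_sub, Matrix.transpose_one, Matrix.transpose_mul, Matrix.diagonal_transpose]

theorem transpose_opinionLimit {n : ℕ} (W : Matrix (Fin n) (Fin n) ℝ) (θ : Fin n → ℝ) :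
    (opinionLimit θ W)ᵀ = (1 - Matrix.diagonal θ) * (1 - Wᵀ * Matrix.diagonal θ)⁻¹ := by
  rw [opinionLimit, Matrix.transpose_mul, Matrix.transpose_nonsing_inv,
    transpose_one_sub_diagonal_mul, Matrix.transpose_sub, Matrix.transpose_one,
    Matrix.diagonal_transpose]

theorem issueMap_eq_transpose_opinionLimit_mulVec {n : ℕ} (C : Matrix (Fin n) (Fin n) ℝ)
    (θ x : Fin n → ℝ) :
    issueMap C θ x = (opinionLimit θ (influence C x))ᵀ *ᵥ democracy n := by
  rw [transpose_opinionLimit, issueMap]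

theorem isUnit_one_sub_transpose_mul_diagonal {n : ℕ} {W : Matrix (Fin n) (Fin n) ℝ}
    {θ : Fin n → ℝ} (hW : W ∈ Matrix.rowStochastic ℝ (Fin n)) (hθ0 : ∀ i, 0 ≤ θ i)
    (hθ1 : ∀ i, θ i < 1) : IsUnit (1 - Wᵀ * Matrix.diagonal θ) := by
  rw [← transpose_one_sub_diagonal_mul, Matrix.isUnit_transpose]
  exact isUnit_one_sub_diagonal_mul hW hθ0 hθ1

/-! ### Well-posedness and equivalence of the two equilibrium notions -/

theorem democracy_mem_stdSimplex {n : ℕ} (hn : n ≠ 0) : democracy n ∈ stdSimplex ℝ (Fin n) := by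
  refine ⟨fun i => by simp only [democracy]; positivity, ?_⟩
  simp [democracy, hn]

theorem transpose_mulVec_mem_stdSimplex {n : ℕ} {V : Matrix (Fin n) (Fin n) ℝ} {d : Fin n → ℝ}
    (hV : V ∈ Matrix.rowStochastic ℝ (Fin n)) (hd : d ∈ stdSimplex ℝ (Fin n)) :
    Vᵀ *ᵥ d ∈ stdSimplex ℝ (Fin n) := by
  rw [Matrix.mem_rowStochastic_iff_sum] at hV
  refine ⟨fun i => ?_, ?_⟩
  · change 0 ≤ ∑ j, V j i * d j
    exact Finset.sum_nonneg fun j _ => mul_nonneg (hV.1 j i) (hd.1 j)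
  simp only [Matrix.mulVec, dotProduct, Matrix.transpose_apply]
  rw [Finset.sum_comm]
  simp only [← Finset.sum_mul, hV.2, one_mul, hd.2]

theorem mapsTo_issueMap {n : ℕ} (hn : n ≠ 0) {C : Matrix (Fin n) (Fin n) ℝ} {θ : Fin n → ℝ}
    (hC : C ∈ Matrix.rowStochastic ℝ (Fin n)) (hθ0 : ∀ i, 0 ≤ θ i) (hθ1 : ∀ i, θ i < 1) :
    Set.MapsTo (issueMap C θ) (stdSimplex ℝ (Fin n)) (stdSimplex ℝ (Fin n)) := by
  intro x hx
  rw [issueMap_eq_transpose_opinionLimit_mulVec]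
  exact transpose_mulVec_mem_stdSimplex
    (opinionLimit_mem_rowStochastic (influence_mem_rowStochastic hC hx) hθ0 hθ1)
    (democracy_mem_stdSimplex hn)

theorem mapsTo_singleIssueMap {n : ℕ} (hn : n ≠ 0) {C : Matrix (Fin n) (Fin n) ℝ} {θ : Fin n → ℝ}
    (hC : C ∈ Matrix.rowStochastic ℝ (Fin n)) (hθ0 : ∀ i, 0 ≤ θ i) (hθ1 : ∀ i, θ i < 1) :
    Set.MapsTo (singleIssueMap C θ)
      ((Matrix.rowStochastic ℝ (Fin n) : Set (Matrix (Fin n) (Fin n) ℝ)) ×ˢ stdSimplex ℝ (Fin n))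
      ((Matrix.rowStochastic ℝ (Fin n) : Set (Matrix (Fin n) (Fin n) ℝ)) ×ˢ
        stdSimplex ℝ (Fin n)) := by
  rintro ⟨V, x⟩ ⟨hV, hx⟩
  have hWV : influence C x * V ∈ Matrix.rowStochastic ℝ (Fin n) :=
    mul_mem (influence_mem_rowStochastic hC hx) hV
  have key : singleIssueV C θ (V, x) ∈ Matrix.rowStochastic ℝ (Fin n) := by
    have e : ∀ i j, singleIssueV C θ (V, x) i j =
        θ i * (influence C x * V) i j + if i = j then 1 - θ i else 0 := by
      intro i j
      rw [singleIssueV, Matrix.mul_assoc, Matrix.sub_apply, Matrix.add_apply, Matrix.diagonal_mul,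
        Matrix.one_apply, Matrix.diagonal_apply]
      split_ifs <;> ring
    rw [Matrix.mem_rowStochastic_iff_sum] at hWV ⊢
    refine ⟨fun i j => ?_, fun i => ?_⟩
    · rw [e]
      refine add_nonneg (mul_nonneg (hθ0 i) (hWV.1 i j)) ?_
      split_ifs
      exacts [by linarith [hθ1 i], le_rfl]
    · simp only [e, Finset.sum_add_distrib, ← Finset.mul_sum, hWV.2, Finset.sum_ite_eq,
        Finset.mem_univ, if_true]
      ring
  exact ⟨key, transpose_mulVec_mem_stdSimplex key (democracy_mem_stdSimplex hn)⟩

theorem isSingleIssueEquilibrium_iff {n : ℕ} {C : Matrix (Fin n) (Fin n) ℝ} {θ : Fin n → ℝ}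
    (hC : C ∈ Matrix.rowStochastic ℝ (Fin n)) (hθ0 : ∀ i, 0 ≤ θ i) (hθ1 : ∀ i, θ i < 1)
    (x : Fin n → ℝ) : (∃ V, IsSingleIssueEquilibrium C θ V x) ↔ IsIssueEquilibrium C θ x := by
  constructor
  · rintro ⟨V, hV, hx, hfix⟩
    refine ⟨hx, ?_⟩
    have hVfix : singleIssueV C θ (V, x) = V := congrArg Prod.fst hfix
    have hxfix : (singleIssueV C θ (V, x))ᵀ *ᵥ democracy n = x := congrArg Prod.snd hfix
    have h := (eq_opinionLimit_iff (influence_mem_rowStochastic hC hx) hθ0 hθ1 V).2 hVfix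
    rw [hVfix, h] at hxfix
    rw [Function.IsFixedPt, issueMap_eq_transpose_opinionLimit_mulVec, hxfix]
  · rintro ⟨hx, hfix⟩
    have hW := influence_mem_rowStochastic hC hx
    have h : singleIssueV C θ (opinionLimit θ (influence C x), x) = _ :=
      (eq_opinionLimit_iff hW hθ0 hθ1 _).1 rfl
    refine ⟨_, opinionLimit_mem_rowStochastic hW hθ0 hθ1, hx, ?_⟩
    rw [Function.IsFixedPt, issueMap_eq_transpose_opinionLimit_mulVec] at hfix
    rw [Function.IsFixedPt, singleIssueMap, h, hfix]

/-! ### Linear system and bounds for the social power -/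

theorem one_sub_transpose_influence_mul_mulVec_apply {n : ℕ} (C : Matrix (Fin n) (Fin n) ℝ)
    (θ x y : Fin n → ℝ) (i : Fin n) :
    ((1 - (influence C x)ᵀ * Matrix.diagonal θ) *ᵥ y) i =
      y i - (x i * (θ i * y i) + ∑ j, C j i * ((1 - x j) * (θ j * y j))) := by
  rw [Matrix.sub_mulVec, Matrix.one_mulVec, Pi.sub_apply, ← Matrix.mulVec_mulVec]
  congr 1
  simp only [influence, Matrix.sub_mul, Matrix.one_mul, Matrix.mulVec, dotProduct,
    Matrix.transpose_apply, Matrix.add_apply, Matrix.sub_apply, Matrix.diagonal_mul,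
    Matrix.diagonal_apply, ite_mul, zero_mul, Finset.sum_ite_eq, Finset.mem_univ, if_true,
    add_mul, Finset.sum_add_distrib, Finset.sum_ite_eq']
  congr 1
  exact Finset.sum_congr rfl fun j _ => by ring

/-- The defining linear system of the issue map, written for the social power `p`. -/
theorem issueMap_eq_iff {n : ℕ} {C : Matrix (Fin n) (Fin n) ℝ} {θ x : Fin n → ℝ}
    (hC : C ∈ Matrix.rowStochastic ℝ (Fin n)) (hθ0 : ∀ i, 0 ≤ θ i) (hθ1 : ∀ i, θ i < 1)
    (hx : x ∈ stdSimplex ℝ (Fin n)) (p : Fin n → ℝ) :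
    issueMap C θ x = p ↔ ∀ i, p i / (1 - θ i) =
      1 / (n : ℝ) + x i * (θ i * (p i / (1 - θ i))) +
        ∑ j, C j i * ((1 - x j) * (θ j * (p j / (1 - θ j)))) := by
  have hu := (Matrix.isUnit_iff_isUnit_det _).1
    (isUnit_one_sub_transpose_mul_diagonal (influence_mem_rowStochastic hC hx) hθ0 hθ1)
  have hne : ∀ i, 1 - θ i ≠ 0 := fun i => by linarith [hθ1 i]
  set A := 1 - (influence C x)ᵀ * Matrix.diagonal θ with hA
  have hp : (1 - Matrix.diagonal θ) *ᵥ (fun i => p i / (1 - θ i)) = p := by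
    ext i
    rw [Matrix.sub_mulVec, Matrix.one_mulVec, Pi.sub_apply, Matrix.mulVec_diagonal]
    field_simp [hne i]
  have h1 : issueMap C θ x = p ↔ A *ᵥ (fun i => p i / (1 - θ i)) = democracy n := by
    rw [issueMap, ← hA, ← Matrix.mulVec_mulVec]
    constructor
    · intro h
      have : A⁻¹ *ᵥ democracy n = fun i => p i / (1 - θ i) := by
        ext i
        rw [← h, Matrix.sub_mulVec, Matrix.one_mulVec, Pi.sub_apply, Matrix.mulVec_diagonal]
        field_simp [hne i]
      rw [← this, Matrix.mulVec_mulVec, Matrix.mul_nonsing_inv _ hu, Matrix.one_mulVec]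
    · intro h
      rw [← h, Matrix.mulVec_mulVec _ A⁻¹, Matrix.nonsing_inv_mul _ hu,
        Matrix.one_mulVec, hp]
  rw [h1, funext_iff]
  refine forall_congr' fun i => ?_
  rw [hA, one_sub_transpose_influence_mul_mulVec_apply, democracy]
  constructor <;> intro h <;> linarith

theorem issueMap_apply {n : ℕ} (C : Matrix (Fin n) (Fin n) ℝ) (θ x : Fin n → ℝ) (i : Fin n) :
    issueMap C θ x i = (∑ j, opinionLimit θ (influence C x) j i) / n := by
  rw [issueMap_eq_transpose_opinionLimit_mulVec]
  simp only [Matrix.mulVec, dotProduct, Matrix.transpose_apply, democracy, ← Finset.sum_mul]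
  ring

/-- Off the diagonal, row `i` is `θ i` times an average of entries that are at most `1`. -/
theorem opinionLimit_apply_le {n : ℕ} {W : Matrix (Fin n) (Fin n) ℝ} {θ : Fin n → ℝ}
    (hW : W ∈ Matrix.rowStochastic ℝ (Fin n)) (hθ0 : ∀ i, 0 ≤ θ i) (hθ1 : ∀ i, θ i < 1)
    {i j : Fin n} (hij : i ≠ j) : opinionLimit θ W i j ≤ θ i := by
  have hV := opinionLimit_mem_rowStochastic hW hθ0 hθ1
  have hWV : (W * opinionLimit θ W) i j ≤ 1 :=
    Matrix.le_one_of_mem_rowStochastic (mul_mem hW hV)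
  rw [Matrix.mul_apply] at hWV
  rw [opinionLimit_apply hW hθ0 hθ1, if_neg hij, add_zero]
  exact mul_le_of_le_one_right (hθ0 i) hWV

/-- A positive self-weight puts `V i j ≤ θ i < 1` into the average, which is then strictly below
`1`. -/
theorem opinionLimit_apply_lt {n : ℕ} {W : Matrix (Fin n) (Fin n) ℝ} {θ : Fin n → ℝ}
    (hW : W ∈ Matrix.rowStochastic ℝ (Fin n)) (hθ0 : ∀ i, 0 ≤ θ i) (hθ1 : ∀ i, θ i < 1)
    {i j : Fin n} (hij : i ≠ j) (hi : 0 < θ i) (hWi : 0 < W i i) : opinionLimit θ W i j < θ i := by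
  have hV := opinionLimit_mem_rowStochastic hW hθ0 hθ1
  have hVij : opinionLimit θ W i j < 1 :=
    (opinionLimit_apply_le hW hθ0 hθ1 hij).trans_lt (hθ1 i)
  have hWV : ∑ k, W i k * opinionLimit θ W k j < ∑ k, W i k := by
    refine Finset.sum_lt_sum (fun k _ => ?_) ⟨i, Finset.mem_univ i, ?_⟩
    · exact mul_le_of_le_one_right (Matrix.nonneg_of_mem_rowStochastic hW)
        (Matrix.le_one_of_mem_rowStochastic hV)
    · exact mul_lt_of_lt_one_right hWi hVij
  rw [Matrix.sum_row_of_mem_rowStochastic hW] at hWV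
  rw [opinionLimit_apply hW hθ0 hθ1, if_neg hij, add_zero]
  exact mul_lt_of_lt_one_right hi hWV

/-- Column `i` of `V` sums to at most `1 + ∑ j ≠ i, θ j`, and dropping `θ i` removes at least the
minimum. -/
theorem issueMap_apply_le {n : ℕ} (hn : n ≠ 0) {C : Matrix (Fin n) (Fin n) ℝ} {θ x : Fin n → ℝ}
    (hC : C ∈ Matrix.rowStochastic ℝ (Fin n)) (hθ0 : ∀ i, 0 ≤ θ i) (hθ1 : ∀ i, θ i < 1)
    (hx : x ∈ stdSimplex ℝ (Fin n)) (i : Fin n) : issueMap C θ x i ≤ (1 + zeta θ) / n := by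
  have hn' : (n : ℝ) ≠ 0 := Nat.cast_ne_zero.2 hn
  have hW := influence_mem_rowStochastic hC hx
  have hV := opinionLimit_mem_rowStochastic hW hθ0 hθ1
  rw [issueMap_apply]
  gcongr
  have hmin : thetaMin θ ≤ θ i := ciInf_le (Set.finite_range θ).bddBelow i
  have hz : zeta θ = ∑ j, θ j - thetaMin θ := by
    rw [zeta, thetaAve, mul_div_cancel₀ _ hn']
  calc ∑ j, opinionLimit θ (influence C x) j i
      ≤ ∑ j, (θ j + if i = j then 1 - θ i else 0) := by
        refine Finset.sum_le_sum fun j _ => ?_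
        split_ifs with h
        · subst h
          have := Matrix.le_one_of_mem_rowStochastic hV (i := i) (j := i)
          linarith
        · rw [add_zero]
          exact opinionLimit_apply_le hW hθ0 hθ1 (Ne.symm h)
    _ ≤ 1 + zeta θ := by
        rw [Finset.sum_add_distrib, Finset.sum_ite_eq, if_pos (Finset.mem_univ i), hz]
        linarith

/-! ### Estimates in the 1-norm -/

theorem abs_transpose_mulVec_sum_le {n : ℕ} {V : Matrix (Fin n) (Fin n) ℝ}
    (hV : V ∈ Matrix.rowStochastic ℝ (Fin n)) (r : Fin n → ℝ) :
    ∑ i, |∑ j, V j i * r j| ≤ ∑ j, |r j| := by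
  calc ∑ i, |∑ j, V j i * r j| ≤ ∑ i, ∑ j, V j i * |r j| := by
        refine Finset.sum_le_sum fun i _ => (Finset.abs_sum_le_sum_abs _ _).trans ?_
        refine Finset.sum_le_sum fun j _ => ?_
        rw [abs_mul, abs_of_nonneg (Matrix.nonneg_of_mem_rowStochastic hV)]
    _ = ∑ j, |r j| := by
        rw [Finset.sum_comm]
        simp only [← Finset.sum_mul, Matrix.sum_row_of_mem_rowStochastic hV, one_mul]

/-- Since `p` is arbitrary, a value of the issue map at another point can be written with the same
`V(x)ᵀ` as the value at `x`. -/
theorem eq_transpose_opinionLimit_sum {n : ℕ} {C : Matrix (Fin n) (Fin n) ℝ} {θ x : Fin n → ℝ}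
    (hC : C ∈ Matrix.rowStochastic ℝ (Fin n)) (hθ0 : ∀ i, 0 ≤ θ i) (hθ1 : ∀ i, θ i < 1)
    (hx : x ∈ stdSimplex ℝ (Fin n)) (p : Fin n → ℝ) (i : Fin n) :
    p i = ∑ j, opinionLimit θ (influence C x) j i * (p j / (1 - θ j) -
      (x j * (θ j * (p j / (1 - θ j))) +
        ∑ k, C k j * ((1 - x k) * (θ k * (p k / (1 - θ k)))))) := by
  have hu := (Matrix.isUnit_iff_isUnit_det _).1
    (isUnit_one_sub_transpose_mul_diagonal (influence_mem_rowStochastic hC hx) hθ0 hθ1)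
  have h : (opinionLimit θ (influence C x))ᵀ *ᵥ ((1 - (influence C x)ᵀ * Matrix.diagonal θ) *ᵥ
      fun i => p i / (1 - θ i)) = p := by
    rw [transpose_opinionLimit, ← Matrix.mulVec_mulVec, Matrix.mulVec_mulVec _ (_)⁻¹,
      Matrix.nonsing_inv_mul _ hu, Matrix.one_mulVec]
    ext i
    have : 1 - θ i ≠ 0 := by linarith [hθ1 i]
    rw [Matrix.sub_mulVec, Matrix.one_mulVec, Pi.sub_apply, Matrix.mulVec_diagonal]
    field_simp
  refine (congrFun h i).symm.trans ?_
  change ∑ j, opinionLimit θ (influence C x) j i * (_ *ᵥ _) j = _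
  refine Finset.sum_congr rfl fun j _ => ?_
  rw [one_sub_transpose_influence_mul_mulVec_apply]

theorem sum_abs_issueMap_sub_le {n : ℕ} {C : Matrix (Fin n) (Fin n) ℝ} {θ x x' : Fin n → ℝ}
    (hC : C ∈ Matrix.rowStochastic ℝ (Fin n)) (hθ0 : ∀ i, 0 ≤ θ i) (hθ1 : ∀ i, θ i < 1)
    (hx : x ∈ stdSimplex ℝ (Fin n)) (hx' : x' ∈ stdSimplex ℝ (Fin n)) {B : ℝ}
    (hB : ∀ i, |θ i * (issueMap C θ x' i / (1 - θ i))| ≤ B) :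
    ∑ i, |issueMap C θ x i - issueMap C θ x' i| ≤ 2 * B * ∑ i, |x i - x' i| := by
  have hCnn : ∀ i j, 0 ≤ C i j := fun i j => Matrix.nonneg_of_mem_rowStochastic hC
  set p := issueMap C θ x' with hp
  have hsys := (issueMap_eq_iff hC hθ0 hθ1 hx' p).1 rfl
  set w : Fin n → ℝ := fun i => θ i * (p i / (1 - θ i)) with hw
  -- This is `(W(x) - W(x'))ᵀ w`. Its two parts each contribute at most `B‖x - x'‖₁`, whence the
  -- factor `2`.
  set r : Fin n → ℝ := fun j => (x j - x' j) * w j - ∑ k, C k j * ((x k - x' k) * w k) with hr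
  have hdiff : ∀ i, issueMap C θ x i - p i =
      ∑ j, opinionLimit θ (influence C x) j i * r j := by
    intro i
    rw [eq_transpose_opinionLimit_sum hC hθ0 hθ1 hx p i, issueMap_apply, Finset.sum_div,
      ← Finset.sum_sub_distrib]
    refine Finset.sum_congr rfl fun j _ => ?_
    have hsum : ∑ k, C k j * ((x k - x' k) * w k) =
        ∑ k, C k j * ((1 - x' k) * w k) - ∑ k, C k j * ((1 - x k) * w k) := by
      rw [← Finset.sum_sub_distrib]
      exact Finset.sum_congr rfl fun k _ => by ring
    simp only [hr, hsum]
    simp only [hw]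
    linear_combination (-opinionLimit θ (influence C x) j i) * hsys j
  simp only [hdiff]
  refine (abs_transpose_mulVec_sum_le (opinionLimit_mem_rowStochastic
    (influence_mem_rowStochastic hC hx) hθ0 hθ1) r).trans ?_
  have hB' : ∀ j, |(x j - x' j) * w j| ≤ B * |x j - x' j| := fun j => by
    rw [abs_mul, mul_comm]
    exact mul_le_mul_of_nonneg_right (hB j) (abs_nonneg _)
  calc ∑ j, |r j| ≤ ∑ j, (|(x j - x' j) * w j| + ∑ k, C k j * |(x k - x' k) * w k|) := by
        refine Finset.sum_le_sum fun j _ => (abs_sub _ _).trans ?_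
        gcongr
        refine (Finset.abs_sum_le_sum_abs _ _).trans (Finset.sum_le_sum fun k _ => ?_)
        rw [abs_mul, abs_of_nonneg (hCnn k j)]
    _ = 2 * ∑ j, |(x j - x' j) * w j| := by
        rw [Finset.sum_add_distrib, Finset.sum_comm]
        simp only [← Finset.sum_mul, Matrix.sum_row_of_mem_rowStochastic hC, one_mul]
        ring
    _ ≤ 2 * ∑ j, B * |x j - x' j| := by
        gcongr with j
        exact hB' j
    _ = _ := by rw [← Finset.mul_sum]; ring

/-! ### Properties of equilibria -/

theorem IsIssueEquilibrium.properties {n : ℕ} (hn : 2 ≤ n) {C : Matrix (Fin n) (Fin n) ℝ}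
    {θ x : Fin n → ℝ}
    (hC : C ∈ Matrix.rowStochastic ℝ (Fin n)) (hC0 : ∀ i, C i i = 0)
    (hθ0 : ∀ i, 0 ≤ θ i) (hθ1 : ∀ i, θ i < 1) (hθ : ∃ j, 0 < θ j)
    (h : IsIssueEquilibrium C θ x) :
    x ∈ simplexInterior n ∧
      (∀ i, θ i = 0 →
        1 / (n : ℝ) ≤ x i ∧ (x i = 1 / (n : ℝ) ↔ ∀ j, 0 < θ j → C j i = 0)) ∧
      (∀ i, 0 < θ i →
        (1 - θ i) / (n : ℝ) < x i ∧ ((∀ j, 0 < θ j → C j i = 0) → x i < 1 / (n : ℝ))) ∧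
      (⨆ i, x i) < 1 / (n : ℝ) + thetaAve θ := by
  obtain ⟨hx, hfix⟩ := h
  have hn0 : (0 : ℝ) < n := by positivity
  have hpos : ∀ i, 0 < 1 - θ i := fun i => by linarith [hθ1 i]
  have hW := influence_mem_rowStochastic hC hx
  have hV := opinionLimit_mem_rowStochastic hW hθ0 hθ1
  have hCnn : ∀ i j, 0 ≤ C i j := fun i j => Matrix.nonneg_of_mem_rowStochastic hC
  have hsys := (issueMap_eq_iff hC hθ0 hθ1 hx x).1 hfix
  have hx1' : ∀ i, x i ≤ 1 := fun i =>
    hx.2 ▸ Finset.single_le_sum (f := x) (fun j _ => hx.1 j) (Finset.mem_univ i)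
  have hterm0 : ∀ i j, 0 ≤ C j i * ((1 - x j) * (θ j * (x j / (1 - θ j)))) := fun i j =>
    mul_nonneg (hCnn j i) (mul_nonneg (by linarith [hx1' j])
      (mul_nonneg (hθ0 j) (div_nonneg (hx.1 j) (hpos j).le)))
  have hself0 : ∀ i, 0 ≤ x i * (θ i * (x i / (1 - θ i))) := fun i =>
    mul_nonneg (hx.1 i) (mul_nonneg (hθ0 i) (div_nonneg (hx.1 i) (hpos i).le))
  have hxpos : ∀ i, 0 < x i := by
    intro i
    have h1 : 0 < x i / (1 - θ i) := by
      rw [hsys i]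
      have := hself0 i
      have := Finset.sum_nonneg fun j (_ : j ∈ Finset.univ) => hterm0 i j
      positivity
    exact (div_pos_iff_of_pos_right (hpos i)).1 h1
  have hxlt : ∀ i, x i < 1 := by
    intro i
    have : Nontrivial (Fin n) := Fin.nontrivial_iff_two_le.2 hn
    obtain ⟨j, hj⟩ := exists_ne i
    have h1 : ∑ k ∈ {i, j}, x k ≤ ∑ k, x k :=
      Finset.sum_le_sum_of_subset_of_nonneg (Finset.subset_univ _) fun k _ _ => hx.1 k
    rw [Finset.sum_pair hj.symm, hx.2] at h1
    linarith [hxpos j]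
  refine ⟨⟨hxpos, hx.2⟩, fun i hi => ?_, fun i hi => ⟨?_, fun hCi => ?_⟩, ?_⟩
  · have hs := hsys i
    rw [hi] at hs
    simp only [sub_zero, div_one, zero_mul, mul_zero, add_zero] at hs
    have hsum := Finset.sum_nonneg fun j (_ : j ∈ Finset.univ) => hterm0 i j
    refine ⟨by linarith, ?_⟩
    have e : x i = 1 / (n : ℝ) ↔ ∑ j, C j i * ((1 - x j) * (θ j * (x j / (1 - θ j)))) = 0 := by
      constructor <;> intro h <;> linarith
    rw [e, Finset.sum_eq_zero_iff_of_nonneg fun j _ => hterm0 i j]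
    refine ⟨fun h j hj => ?_, fun h j _ => ?_⟩
    · have hne : (1 - x j) * (θ j * (x j / (1 - θ j))) ≠ 0 :=
        (mul_pos (by linarith [hxlt j]) (mul_pos hj (div_pos (hxpos j) (hpos j)))).ne'
      exact (mul_eq_zero.1 (h j (Finset.mem_univ j))).resolve_right hne
    · rcases (hθ0 j).eq_or_lt with hj | hj
      · rw [← hj]; ring
      · rw [h j hj, zero_mul]
  · have hs := hsys i
    have h1 : 0 < x i * (θ i * (x i / (1 - θ i))) :=
      mul_pos (hxpos i) (mul_pos hi (div_pos (hxpos i) (hpos i)))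
    have hsum := Finset.sum_nonneg fun j (_ : j ∈ Finset.univ) => hterm0 i j
    have h2 : 1 / (n : ℝ) < x i / (1 - θ i) := by linarith
    rw [lt_div_iff₀ (hpos i)] at h2
    calc (1 - θ i) / (n : ℝ) = 1 / n * (1 - θ i) := by ring
      _ < x i := h2
  · have hs := hsys i
    have hsum : ∑ j, C j i * ((1 - x j) * (θ j * (x j / (1 - θ j)))) = 0 := by
      refine Finset.sum_eq_zero fun j _ => ?_
      rcases (hθ0 j).eq_or_lt with hj | hj
      · rw [← hj]; ring
      · rw [hCi j hj, zero_mul]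
    rw [hsum, add_zero] at hs
    -- With no incoming influence, `1/n` is `x i` times `(1 - θ i * x i)/(1 - θ i)`, a factor above
    -- `1` because `x i < 1`.
    have hs' : 1 / (n : ℝ) = x i * (1 - θ i * x i) / (1 - θ i) := by
      rw [eq_sub_of_add_eq hs.symm]; ring
    rw [hs', lt_div_iff₀ (hpos i)]
    have : θ i * x i < θ i := mul_lt_of_lt_one_right hi (hxlt i)
    exact mul_lt_mul_of_pos_left (by linarith) (hxpos i)
  · have : Nonempty (Fin n) := ⟨hθ.choose⟩
    obtain ⟨i, hi⟩ := exists_eq_ciSup_of_finite (f := x)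
    obtain ⟨j, hj⟩ := hθ
    -- The zero diagonal of `C` makes the self-weight equal to `x j`, so strictness in the column
    -- sum comes from a partially stubborn `j`.
    have hWj : ∀ j, 0 < influence C x j j := by
      intro j
      simp only [influence, Matrix.sub_mul, Matrix.one_mul, Matrix.add_apply, Matrix.sub_apply,
        Matrix.diagonal_mul, Matrix.diagonal_apply_eq, hC0]
      linarith [hxpos j]
    have key : ∑ j, opinionLimit θ (influence C x) j i < ∑ j, (θ j + if i = j then 1 else 0) := by
      refine Finset.sum_lt_sum (fun k _ => ?_) ⟨j, Finset.mem_univ j, ?_⟩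
      · split_ifs with h
        · have := Matrix.le_one_of_mem_rowStochastic hV (i := k) (j := i)
          linarith [hθ0 k]
        · rw [add_zero]
          exact opinionLimit_apply_le hW hθ0 hθ1 (Ne.symm h)
      · split_ifs with h
        · have := Matrix.le_one_of_mem_rowStochastic hV (i := j) (j := i)
          linarith
        · rw [add_zero]
          exact opinionLimit_apply_lt hW hθ0 hθ1 (Ne.symm h) hj (hWj j)
    rw [Finset.sum_add_distrib, Finset.sum_ite_eq, if_pos (Finset.mem_univ i)] at key
    rw [← hi, ← congrFun hfix i, issueMap_apply, thetaAve, ← add_div, add_comm (1 : ℝ)]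
    gcongr

/-! ### Existence of an equilibrium -/

/-- Componentwise `K`-Lipschitz nonlinearities, followed by a row-stochastic transfer, have a
fixed point. -/
theorem exists_eq_add_sum_of_lipschitz {n : ℕ} {C : Matrix (Fin n) (Fin n) ℝ}
    (hC : C ∈ Matrix.rowStochastic ℝ (Fin n)) {K : ℝ} (hK1 : K < 1)
    (b : Fin n → ℝ) (φ : Fin n → ℝ → ℝ) (hφ : ∀ j u v, |φ j u - φ j v| ≤ K * |u - v|) :
    ∃ u : Fin n → ℝ, ∀ i, u i = b i + ∑ j, C j i * φ j (u j) := by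
  let f : PiLp 1 (fun _ : Fin n => ℝ) → PiLp 1 (fun _ : Fin n => ℝ) :=
    fun u => WithLp.toLp 1 fun i => b i + ∑ j, C j i * φ j (u j)
  have hf : ContractingWith (Real.toNNReal K) f := by
    refine ⟨Real.toNNReal_lt_one.2 hK1, LipschitzWith.of_dist_le_mul fun u v => ?_⟩
    rw [PiLp.dist_eq_of_L1, PiLp.dist_eq_of_L1, Finset.mul_sum]
    have h1 : ∑ i, dist (f u i) (f v i) = ∑ i, |∑ j, C j i * (φ j (u j) - φ j (v j))| := by
      refine Finset.sum_congr rfl fun i _ => ?_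
      change |(b i + ∑ j, C j i * φ j (u j)) - (b i + ∑ j, C j i * φ j (v j))| = _
      rw [add_sub_add_left_eq_sub, ← Finset.sum_sub_distrib]
      simp only [mul_sub]
    rw [h1]
    refine (abs_transpose_mulVec_sum_le hC _).trans (Finset.sum_le_sum fun j _ => ?_)
    refine (hφ j _ _).trans ?_
    rw [Real.dist_eq]
    exact mul_le_mul_of_nonneg_right (Real.le_coe_toNNReal K) (abs_nonneg _)
  obtain ⟨u, hu⟩ : ∃ u, f u = u := ⟨_, hf.fixedPoint_isFixedPt⟩
  exact ⟨fun i => u i, fun i => (congrArg (fun v : PiLp 1 (fun _ : Fin n => ℝ) => v i) hu).symm⟩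

/-- Stability of the solutions of `u = b + Cᵀ φ(u)` under perturbations of `φ`. -/
theorem sum_abs_sub_le_of_lipschitz {n : ℕ} {C : Matrix (Fin n) (Fin n) ℝ}
    (hC : C ∈ Matrix.rowStochastic ℝ (Fin n)) {K : ℝ}
    {b : Fin n → ℝ} {φ ψ : Fin n → ℝ → ℝ} (hφ : ∀ j u v, |φ j u - φ j v| ≤ K * |u - v|)
    {u v : Fin n → ℝ} (hu : ∀ i, u i = b i + ∑ j, C j i * φ j (u j))
    (hv : ∀ i, v i = b i + ∑ j, C j i * ψ j (v j)) :
    (1 - K) * ∑ i, |u i - v i| ≤ ∑ j, |φ j (v j) - ψ j (v j)| := by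
  have h1 : ∑ i, |u i - v i| ≤ ∑ j, |φ j (u j) - ψ j (v j)| := by
    refine le_trans (le_of_eq ?_) (abs_transpose_mulVec_sum_le hC _)
    refine Finset.sum_congr rfl fun i _ => ?_
    rw [hu i, hv i, add_sub_add_left_eq_sub, ← Finset.sum_sub_distrib]
    simp only [mul_sub]
  have h2 : ∑ j, |φ j (u j) - ψ j (v j)| ≤
      K * ∑ j, |u j - v j| + ∑ j, |φ j (v j) - ψ j (v j)| := by
    rw [Finset.mul_sum, ← Finset.sum_add_distrib]
    exact Finset.sum_le_sum fun j _ =>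
      (abs_sub_le _ (φ j (v j)) _).trans (add_le_add_left (hφ j _ _) _)
  linarith

/-- The influence passed on by an individual with susceptibility `θ` and social power `x`. -/
noncomputable def passedInfluence (θ x : ℝ) : ℝ := θ * (x * (1 - x) / (1 - θ))

/-- `passedInfluence` made monotone by clamping its argument to `[0, 1/2]`. -/
noncomputable def clampedInfluence (θ x : ℝ) : ℝ :=
  passedInfluence θ (max 0 (min x (1 / 2)))

theorem continuous_passedInfluence (θ : ℝ) : Continuous (passedInfluence θ) := by
  unfold passedInfluence
  fun_prop

theorem clampedInfluence_of_le {θ x : ℝ} (h0 : 0 ≤ x) (h1 : x ≤ 1 / 2) :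
    clampedInfluence θ x = passedInfluence θ x := by
  rw [clampedInfluence, min_eq_left h1, max_eq_right h0]

theorem clampedInfluence_of_ge {θ x : ℝ} (h : 1 / 2 ≤ x) :
    clampedInfluence θ x = passedInfluence θ (1 / 2) := by
  rw [clampedInfluence, min_eq_right h, max_eq_right (by norm_num)]

theorem clampedInfluence_of_nonpos {θ x : ℝ} (h : x ≤ 0) : clampedInfluence θ x = 0 := by
  rw [clampedInfluence, max_eq_left ((min_le_left _ _).trans h), passedInfluence]
  ring

theorem passedInfluence_nonneg {θ x : ℝ} (hθ0 : 0 ≤ θ) (hθ1 : θ < 1) (h0 : 0 ≤ x) (h1 : x ≤ 1) :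
    0 ≤ passedInfluence θ x :=
  mul_nonneg hθ0 (div_nonneg (mul_nonneg h0 (by linarith)) (by linarith))

theorem clampedInfluence_nonneg {θ : ℝ} (hθ0 : 0 ≤ θ) (hθ1 : θ < 1) (x : ℝ) :
    0 ≤ clampedInfluence θ x :=
  passedInfluence_nonneg hθ0 hθ1 (le_max_left _ _)
    (max_le (by norm_num) ((min_le_right _ _).trans (by norm_num)))

/-- For clamped arguments `a ≤ b` the difference quotient is `θ(1 - a - b)/(1 - θ)` with `0 ≤ 1 - a
- b ≤ 1`. -/
theorem clampedInfluence_sub_bounds {θ : ℝ} (hθ0 : 0 ≤ θ) (hθ1 : θ < 1) {x y : ℝ} (h : x ≤ y) :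
    0 ≤ clampedInfluence θ y - clampedInfluence θ x ∧
      (1 - θ) * (clampedInfluence θ y - clampedInfluence θ x) ≤ θ * (y - x) := by
  have hpos : 0 < 1 - θ := by linarith
  unfold clampedInfluence
  set a := max 0 (min x (1 / 2)) with ha
  set b := max 0 (min y (1 / 2)) with hb
  have ha0 : 0 ≤ a := le_max_left _ _
  have hb2 : b ≤ 1 / 2 := max_le (by norm_num) (min_le_right _ _)
  have hab : a ≤ b := max_le_max le_rfl (min_le_min h le_rfl)
  have hba : b - a ≤ y - x := by
    rw [ha, hb]
    rcases max_cases 0 (min x (1 / 2)) with h1 | h1 <;>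
    rcases max_cases 0 (min y (1 / 2)) with h2 | h2 <;>
    rcases min_cases x (1 / 2) with h3 | h3 <;>
    rcases min_cases y (1 / 2) with h4 | h4 <;> linarith
  have e : passedInfluence θ b - passedInfluence θ a = θ * ((b - a) * (1 - a - b)) / (1 - θ) := by
    unfold passedInfluence; ring
  rw [e]
  constructor
  · exact div_nonneg (mul_nonneg hθ0 (mul_nonneg (by linarith) (by linarith))) hpos.le
  · rw [mul_div_cancel₀ _ hpos.ne']
    refine mul_le_mul_of_nonneg_left ?_ hθ0
    nlinarith

theorem continuous_clampedInfluence (θ : ℝ) : Continuous (clampedInfluence θ) := by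
  unfold clampedInfluence
  exact (continuous_passedInfluence θ).comp (by fun_prop)

/-- The power `x` with `x + clampedInfluence θ x = u` depends monotonically on the weight `u`, and
the influence passed on is a contraction of `u`. -/
theorem exists_add_clampedInfluence_eq {θ : ℝ} (hθ0 : 0 ≤ θ) (hθ1 : θ < 1) :
    ∃ ψ : ℝ → ℝ, (∀ u, ψ u + clampedInfluence θ (ψ u) = u) ∧
      (∀ u v, |clampedInfluence θ (ψ u) - clampedInfluence θ (ψ v)| ≤ θ * |u - v|) := by
  have hsurj : Function.Surjective fun x => x + clampedInfluence θ x := by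
    refine (continuous_id.add (continuous_clampedInfluence θ)).surjective ?_ ?_
    · exact Filter.tendsto_atTop_mono
        (fun x => le_add_of_nonneg_right (clampedInfluence_nonneg hθ0 hθ1 x)) Filter.tendsto_id
    · refine Filter.tendsto_id.congr' ?_
      filter_upwards [Filter.eventually_le_atBot 0] with x hx
      simp [clampedInfluence_of_nonpos hx]
  choose ψ hψ using hsurj
  refine ⟨ψ, hψ, ?_⟩
  -- If `d` is the increase of the clamped influence, then `(1 - θ)d ≤ θ(ψ v - ψ u)` and `v - u = (ψ
  -- v - ψ u) + d`, hence `d ≤ θ(v - u)`.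
  have key : ∀ u v, ψ u ≤ ψ v →
      |clampedInfluence θ (ψ v) - clampedInfluence θ (ψ u)| ≤ θ * |v - u| := by
    intro u v h
    obtain ⟨h1, h2⟩ := clampedInfluence_sub_bounds hθ0 hθ1 h
    have hu : ψ u + clampedInfluence θ (ψ u) = u := hψ u
    have hv : ψ v + clampedInfluence θ (ψ v) = v := hψ v
    rw [abs_of_nonneg h1, abs_of_nonneg (by linarith)]
    nlinarith
  intro u v
  rcases le_total (ψ u) (ψ v) with h | h
  · rw [abs_sub_comm, abs_sub_comm u]
    exact key u v h
  · exact key v u h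

/-- The equilibrium equations of the issue-sequence model in terms of the influence passed on. -/
theorem isIssueEquilibrium_of_add_passedInfluence_eq {n : ℕ} (hn : n ≠ 0)
    {C : Matrix (Fin n) (Fin n) ℝ} {θ x : Fin n → ℝ}
    (hC : C ∈ Matrix.rowStochastic ℝ (Fin n)) (hθ0 : ∀ i, 0 ≤ θ i) (hθ1 : ∀ i, θ i < 1)
    (hx : ∀ i, 0 ≤ x i)
    (h : ∀ i, x i + passedInfluence (θ i) (x i) =
      1 / (n : ℝ) + ∑ j, C j i * passedInfluence (θ j) (x j)) :
    IsIssueEquilibrium C θ x := by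
  have hsum : ∑ i, x i = 1 := by
    have h1 : ∑ i, (x i + passedInfluence (θ i) (x i)) =
        ∑ i, (1 / (n : ℝ) + ∑ j, C j i * passedInfluence (θ j) (x j)) :=
      Finset.sum_congr rfl fun i _ => h i
    rw [Finset.sum_add_distrib, Finset.sum_add_distrib,
      Finset.sum_comm (f := fun i j => _ * _)] at h1
    simp only [← Finset.sum_mul, Matrix.sum_row_of_mem_rowStochastic hC, one_mul] at h1
    have h2 : ∑ _i : Fin n, 1 / (n : ℝ) = 1 := by simp [hn]
    linarith
  refine ⟨⟨hx, hsum⟩, (issueMap_eq_iff hC hθ0 hθ1 ⟨hx, hsum⟩ x).2 fun i => ?_⟩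
  have hne : 1 - θ i ≠ 0 := by linarith [hθ1 i]
  have e : ∑ j, C j i * ((1 - x j) * (θ j * (x j / (1 - θ j)))) =
      ∑ j, C j i * passedInfluence (θ j) (x j) :=
    Finset.sum_congr rfl fun j _ => by unfold passedInfluence; ring
  rw [e, add_right_comm, ← h i, passedInfluence]
  field_simp
  ring

theorem exists_isIssueEquilibrium {n : ℕ} (hn : n ≠ 0)
    {C : Matrix (Fin n) (Fin n) ℝ} {θ : Fin n → ℝ}
    (hC : C ∈ Matrix.rowStochastic ℝ (Fin n)) (hθ0 : ∀ i, 0 ≤ θ i) (hθ1 : ∀ i, θ i < 1) :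
    ∃ x, IsIssueEquilibrium C θ x := by
  have : Nonempty (Fin n) := ⟨⟨0, Nat.pos_of_ne_zero hn⟩⟩
  have hCnn : ∀ i j, 0 ≤ C i j := fun i j => Matrix.nonneg_of_mem_rowStochastic hC
  obtain ⟨k, hk⟩ := Finite.exists_max θ
  choose ψ hψ hψlip using fun i => exists_add_clampedInfluence_eq (hθ0 i) (hθ1 i)
  set g : Fin n → ℝ → ℝ := fun j u => clampedInfluence (θ j) (ψ j u) with hg
  have hglip : ∀ j u v, |g j u - g j v| ≤ θ k * |u - v| := fun j u v =>
    (hψlip j u v).trans (mul_le_mul_of_nonneg_right (hk j) (abs_nonneg _))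
  have hgnn : ∀ j u, 0 ≤ g j u := fun j u => clampedInfluence_nonneg (hθ0 j) (hθ1 j) _
  have hψnn : ∀ j u, 0 ≤ u → 0 ≤ ψ j u := by
    intro j u hu
    by_contra! h
    have := hψ j u
    rw [clampedInfluence_of_nonpos h.le] at this
    linarith
  have hψeq : ∀ j u, ψ j u = u - g j u := fun j u => eq_sub_of_add_eq (hψ j u)
  -- Rows of `C` sum to `1`, so the influence sent equals the influence received.
  have htotal : ∀ (u w : Fin n → ℝ), (∀ i, u i = 1 / (n : ℝ) + ∑ j, C j i * w j) →
      ∑ i, (u i - w i) = 1 := by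
    intro u w h
    have h1 : ∑ i, u i = ∑ i, (1 / (n : ℝ) + ∑ j, C j i * w j) :=
      Finset.sum_congr rfl fun i _ => h i
    rw [Finset.sum_add_distrib, Finset.sum_comm] at h1
    simp only [← Finset.sum_mul, Matrix.sum_row_of_mem_rowStochastic hC, one_mul] at h1
    have h2 : ∑ _i : Fin n, 1 / (n : ℝ) = 1 := by simp [hn]
    rw [Finset.sum_sub_distrib]
    linarith
  have hunn : ∀ (u w : Fin n → ℝ), (∀ i, u i = 1 / (n : ℝ) + ∑ j, C j i * w j) →
      (∀ j, 0 ≤ w j) → ∀ i, 0 ≤ u i := by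
    intro u w h hw i
    rw [h i]
    exact add_nonneg (by positivity)
      (Finset.sum_nonneg fun j _ => mul_nonneg (hCnn j i) (hw j))
  obtain ⟨u₀, hu₀⟩ := exists_eq_add_sum_of_lipschitz hC (hθ1 k) (fun _ => 1 / (n : ℝ)) g hglip
  have hu₀nn := hunn u₀ _ hu₀ fun j => hgnn j _
  by_cases hsmall : ∀ i, ψ i (u₀ i) ≤ 1 / 2
  · refine ⟨fun i => ψ i (u₀ i), isIssueEquilibrium_of_add_passedInfluence_eq hn hC hθ0 hθ1
      (fun i => hψnn i _ (hu₀nn i)) fun i => ?_⟩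
    have e : ∀ j, passedInfluence (θ j) (ψ j (u₀ j)) = g j (u₀ j) := fun j =>
      (clampedInfluence_of_le (hψnn j _ (hu₀nn j)) (hsmall j)).symm
    simp only [e]
    rw [← hu₀ i]
    exact hψ i (u₀ i)
  push Not at hsmall
  obtain ⟨c, hc⟩ := hsmall
  -- The influence sent by the dominant individual `c` becomes a free constant `σ`; the solution `U
  -- σ` is Lipschitz in `σ`.
  set φ : ℝ → Fin n → ℝ → ℝ := fun σ j u => if j = c then σ else g j u with hφ
  have hφlip : ∀ σ j u v, |φ σ j u - φ σ j v| ≤ θ k * |u - v| := by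
    intro σ j u v
    simp only [hφ]
    split_ifs
    · rw [sub_self, abs_zero]
      exact mul_nonneg (hθ0 k) (abs_nonneg _)
    · exact hglip j u v
  choose U hU using fun σ =>
    exists_eq_add_sum_of_lipschitz hC (hθ1 k) (fun _ => 1 / (n : ℝ)) (φ σ) (hφlip σ)
  have hpos : 0 < 1 - θ k := by linarith [hθ1 k]
  have hUcont : ∀ j, Continuous fun σ => U σ j := by
    intro j
    refine (LipschitzWith.of_dist_le_mul (K := Real.toNNReal (1 / (1 - θ k)))
      fun σ τ => ?_).continuous
    rw [Real.coe_toNNReal _ (by positivity), Real.dist_eq, Real.dist_eq, one_div_mul_eq_div,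
      le_div_iff₀ hpos, mul_comm]
    have h1 := sum_abs_sub_le_of_lipschitz hC (hφlip σ) (hU σ) (hU τ)
    have h2 : ∑ j, |φ σ j (U τ j) - φ τ j (U τ j)| = |σ - τ| := by
      rw [Finset.sum_eq_single c]
      · simp [hφ]
      · intro j _ hj
        simp [hφ, hj]
      · simp
    rw [h2] at h1
    refine (mul_le_mul_of_nonneg_left ?_ hpos.le).trans h1
    exact Finset.single_le_sum (f := fun i => |U σ i - U τ i|) (fun i _ => abs_nonneg _)
      (Finset.mem_univ j)
  have hgcont : ∀ j, Continuous (g j) := by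
    intro j
    refine (LipschitzWith.of_dist_le_mul (K := Real.toNNReal (θ k)) fun u v => ?_).continuous
    rw [Real.coe_toNNReal _ (hθ0 k)]
    exact hglip j u v
  set h : ℝ → ℝ := fun t =>
    ∑ j ∈ Finset.univ.erase c, ψ j (U (passedInfluence (θ c) t) j) + t with hh
  have hcont : Continuous h := by
    simp only [hh, hψeq]
    have := continuous_passedInfluence (θ c)
    refine (continuous_finsetSum _ fun j _ => ?_).add continuous_id
    have h1 := (hUcont j).comp this
    exact h1.sub ((hgcont j).comp h1)
  have hUnn : ∀ t, 0 ≤ t → t ≤ 1 → ∀ i, 0 ≤ U (passedInfluence (θ c) t) i := by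
    intro t ht0 ht1
    refine hunn _ _ (hU _) fun j => ?_
    simp only [hφ]
    split_ifs
    exacts [passedInfluence_nonneg (hθ0 c) (hθ1 c) ht0 ht1, hgnn _ _]
  -- At `t = 1/2` the prescribed influence is the clamped value already used in `u₀`, so the
  -- solution is `u₀`. Its total power is `1` with `ψ c (u₀ c) > 1/2`, so replacing that power by
  -- `1/2` cannot raise the total above `1`.
  have hhalf : h (1 / 2) ≤ 1 := by
    have h1 := sum_abs_sub_le_of_lipschitz hC (hφlip (passedInfluence (θ c) (1 / 2))) (hU _) hu₀
    have h2 : ∑ j, |φ (passedInfluence (θ c) (1 / 2)) j (u₀ j) - g j (u₀ j)| = 0 := by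
      refine Finset.sum_eq_zero fun j _ => ?_
      by_cases hj : j = c
      · subst hj
        simp only [hφ, if_true, hg, clampedInfluence_of_ge hc.le, sub_self, abs_zero]
      · simp [hφ, hj]
    rw [h2] at h1
    have h3 : ∑ i, |U (passedInfluence (θ c) (1 / 2)) i - u₀ i| ≤ 0 :=
      nonpos_of_mul_nonpos_right h1 hpos
    have h4 : ∀ i, U (passedInfluence (θ c) (1 / 2)) i = u₀ i := by
      intro i
      have := (Finset.single_le_sum (f := fun i => |U (passedInfluence (θ c) (1 / 2)) i - u₀ i|)
        (fun i _ => abs_nonneg _) (Finset.mem_univ i)).trans h3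
      exact sub_eq_zero.1 (abs_nonpos_iff.1 this)
    have h5 := htotal u₀ _ hu₀
    simp only [← hψeq] at h5
    rw [← Finset.sum_erase_add _ _ (Finset.mem_univ c)] at h5
    simp only [hh, h4]
    linarith
  have hone : 1 ≤ h 1 := by
    simp only [hh]
    refine le_add_of_nonneg_left (Finset.sum_nonneg fun j _ => hψnn j _ ?_)
    exact hUnn 1 zero_le_one le_rfl j
  obtain ⟨t, ⟨ht0, ht1⟩, ht⟩ := intermediate_value_Icc (by norm_num : (1 / 2 : ℝ) ≤ 1)
    hcont.continuousOn ⟨hhalf, hone⟩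
  simp only [hh] at ht
  have hUt := hU (passedInfluence (θ c) t)
  have hUtnn := hUnn t (by linarith) ht1
  set u := U (passedInfluence (θ c) t)
  -- The others share `1 - t ≤ 1/2`.
  have hle : ∀ j, j ≠ c → ψ j (u j) ≤ 1 / 2 := by
    intro j hj
    have := Finset.single_le_sum (f := fun j => ψ j (u j)) (fun j _ => hψnn j _ (hUtnn j))
      (Finset.mem_erase.2 ⟨hj, Finset.mem_univ j⟩)
    linarith
  have hφu : ∀ j, φ (passedInfluence (θ c) t) j (u j) =
      passedInfluence (θ j) (if j = c then t else ψ j (u j)) := by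
    intro j
    by_cases hj : j = c
    · subst hj
      simp [hφ]
    · simp only [hφ, if_neg hj]
      exact clampedInfluence_of_le (hψnn j _ (hUtnn j)) (hle j hj)
  refine ⟨fun j => if j = c then t else ψ j (u j),
    isIssueEquilibrium_of_add_passedInfluence_eq hn hC hθ0 hθ1 (fun i => ?_) fun i => ?_⟩
  · split_ifs
    exacts [by linarith, hψnn i _ (hUtnn i)]
  · simp only [← hφu]
    rw [← hUt i]
    by_cases hi : i = c
    · subst hi
      -- The equation of `c` was given up when its influence was prescribed; it is recovered by
      -- comparing this total with the total power `1` at `t`.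
      have h1 := htotal u _ hUt
      rw [← Finset.sum_erase_add _ _ (Finset.mem_univ i)] at h1
      have h2 : ∑ j ∈ Finset.univ.erase i, (u j - φ (passedInfluence (θ i) t) j (u j)) =
          ∑ j ∈ Finset.univ.erase i, ψ j (u j) := by
        refine Finset.sum_congr rfl fun j hj => ?_
        rw [hψeq]
        simp only [hφ, if_neg (Finset.ne_of_mem_erase hj)]
      rw [h2] at h1
      rw [if_pos rfl]
      linarith
    · rw [if_neg hi]
      simp only [hφ, if_neg hi]
      exact hψ i (u i)

/-! ### Contraction and the main theorem -/

theorem exists_issueMap_contraction {n : ℕ} (hn : n ≠ 0) {C : Matrix (Fin n) (Fin n) ℝ}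
    {θ : Fin n → ℝ}
    (hC : C ∈ Matrix.rowStochastic ℝ (Fin n)) (hθ0 : ∀ i, 0 ≤ θ i) (hθ1 : ∀ i, θ i < 1)
    (h : thetaMax θ < (n : ℝ) / ((n : ℝ) + 2 * (1 + zeta θ))) :
    ∃ κ : ℝ, 0 ≤ κ ∧ κ < 1 ∧
      ∀ y ∈ stdSimplex ℝ (Fin n), ∀ z ∈ stdSimplex ℝ (Fin n),
        ∑ i, |issueMap C θ y i - issueMap C θ z i| ≤ κ * ∑ i, |y i - z i| := by
  have : Nonempty (Fin n) := ⟨⟨0, Nat.pos_of_ne_zero hn⟩⟩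
  have hn0 : (0 : ℝ) < n := Nat.cast_pos.2 (Nat.pos_of_ne_zero hn)
  obtain ⟨k, hk⟩ := exists_eq_ciSup_of_finite (f := θ)
  have hmax : ∀ i, θ i ≤ θ k := fun i => hk ▸ le_ciSup (Set.finite_range θ).bddAbove i
  have hz : 0 ≤ zeta θ := by
    have h1 : thetaMin θ ≤ θ k := ciInf_le (Set.finite_range θ).bddBelow k
    have h2 : θ k ≤ ∑ j, θ j := Finset.single_le_sum (fun j _ => hθ0 j) (Finset.mem_univ k)
    rw [zeta, thetaAve, mul_div_cancel₀ _ hn0.ne']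
    linarith
  have hpos : 0 < 1 - θ k := by linarith [hθ1 k]
  rw [thetaMax, ← hk, lt_div_iff₀ (by positivity)] at h
  -- This is `2B` with `F(z) i ≤ (1 + ζ)/n` and `θ i ≤ θ k` inserted; being below `1` rearranges to
  -- the assumed bound on the largest susceptibility.
  refine ⟨2 * (θ k * ((1 + zeta θ) / n / (1 - θ k))), ?_, ?_, fun y hy z hz' => ?_⟩
  · have := hθ0 k
    positivity
  · have e : 2 * (θ k * ((1 + zeta θ) / n / (1 - θ k))) =
        2 * (θ k * (1 + zeta θ)) / (n * (1 - θ k)) := by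
      field_simp
    rw [e, div_lt_one (by positivity)]
    linarith
  · refine sum_abs_issueMap_sub_le hC hθ0 hθ1 hy hz' fun i => ?_
    have hi : 0 < 1 - θ i := by linarith [hθ1 i]
    have hp0 : 0 ≤ issueMap C θ z i := (mapsTo_issueMap hn hC hθ0 hθ1 hz').1 i
    rw [abs_of_nonneg (mul_nonneg (hθ0 i) (div_nonneg hp0 hi.le))]
    refine mul_le_mul (hmax i) ?_ (div_nonneg hp0 hi.le) (hθ0 k)
    exact div_le_div₀ (by positivity) (issueMap_apply_le hn hC hθ0 hθ1 hz' i) hpos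
      (by linarith [hmax i])

theorem theorem1 (n : ℕ) (hn : 2 ≤ n) (C : Matrix (Fin n) (Fin n) ℝ) (θ : Fin n → ℝ)
    (hC : C ∈ Matrix.rowStochastic ℝ (Fin n)) (hC0 : ∀ i, C i i = 0)
    (hθ0 : ∀ i, 0 ≤ θ i) (hθ1 : ∀ i, θ i < 1) (hθ : ∃ j, 0 < θ j) :
    -- both models are well defined
    (∀ x ∈ stdSimplex ℝ (Fin n), IsUnit (1 - (influence C x)ᵀ * Matrix.diagonal θ)) ∧
    Set.MapsTo (issueMap C θ) (stdSimplex ℝ (Fin n)) (stdSimplex ℝ (Fin n)) ∧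
    Set.MapsTo (singleIssueMap C θ)
      ((Matrix.rowStochastic ℝ (Fin n) : Set (Matrix (Fin n) (Fin n) ℝ)) ×ˢ stdSimplex ℝ (Fin n))
      ((Matrix.rowStochastic ℝ (Fin n) : Set (Matrix (Fin n) (Fin n) ℝ)) ×ˢ
        stdSimplex ℝ (Fin n)) ∧
    -- there is a common equilibrium social power of the two models
    (∃ x, IsIssueEquilibrium C θ x ∧ ∃ V, IsSingleIssueEquilibrium C θ V x) ∧
    -- properties of every equilibrium social power of either model
    (∀ x, (IsIssueEquilibrium C θ x ∨ ∃ V, IsSingleIssueEquilibrium C θ V x) →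
      x ∈ simplexInterior n ∧
      (∀ i, θ i = 0 →
        1 / (n : ℝ) ≤ x i ∧ (x i = 1 / (n : ℝ) ↔ ∀ j, 0 < θ j → C j i = 0)) ∧
      (∀ i, 0 < θ i →
        (1 - θ i) / (n : ℝ) < x i ∧ ((∀ j, 0 < θ j → C j i = 0) → x i < 1 / (n : ℝ))) ∧
      (⨆ i, x i) < 1 / (n : ℝ) + thetaAve θ) ∧
    -- contraction and uniqueness
    (thetaMax θ < (n : ℝ) / ((n : ℝ) + 2 * (1 + zeta θ)) →
      (∃ κ : ℝ, 0 ≤ κ ∧ κ < 1 ∧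
        ∀ y ∈ stdSimplex ℝ (Fin n), ∀ z ∈ stdSimplex ℝ (Fin n),
          ∑ i, |issueMap C θ y i - issueMap C θ z i| ≤ κ * ∑ i, |y i - z i|) ∧
      ∃ xs : Fin n → ℝ,
        (∀ x, IsIssueEquilibrium C θ x ↔ x = xs) ∧
        (∀ x, (∃ V, IsSingleIssueEquilibrium C θ V x) ↔ x = xs)) := by
  have hn0 : n ≠ 0 := by omega
  obtain ⟨xs, hxs⟩ := exists_isIssueEquilibrium hn0 hC hθ0 hθ1
  refine ⟨fun x hx => isUnit_one_sub_transpose_mul_diagonal (influence_mem_rowStochastic hC hx)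
    hθ0 hθ1, mapsTo_issueMap hn0 hC hθ0 hθ1, mapsTo_singleIssueMap hn0 hC hθ0 hθ1,
    ⟨xs, hxs, (isSingleIssueEquilibrium_iff hC hθ0 hθ1 xs).2 hxs⟩, fun x hx => ?_, fun hlt => ?_⟩
  · exact IsIssueEquilibrium.properties hn hC hC0 hθ0 hθ1 hθ
      (hx.elim id (isSingleIssueEquilibrium_iff hC hθ0 hθ1 x).1)
  · obtain ⟨κ, hκ0, hκ1, hκ⟩ := exists_issueMap_contraction hn0 hC hθ0 hθ1 hlt
    have huniq : ∀ x, IsIssueEquilibrium C θ x ↔ x = xs := by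
      refine fun x => ⟨fun hx => ?_, fun hx => hx ▸ hxs⟩
      have h1 := hκ x hx.1 xs hxs.1
      rw [hx.2.eq, hxs.2.eq] at h1
      have h2 : ∑ i, |x i - xs i| ≤ 0 := by nlinarith
      ext i
      have h3 := (Finset.single_le_sum (f := fun i => |x i - xs i|) (fun i _ => abs_nonneg _)
        (Finset.mem_univ i)).trans h2
      exact sub_eq_zero.1 (abs_nonpos_iff.1 h3)
    refine ⟨⟨κ, hκ0, hκ1, hκ⟩, xs, huniq, fun x => ?_⟩
    rw [isSingleIssueEquilibrium_iff hC hθ0 hθ1 x, huniq x]
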